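/- Let $X$ be a finite set and let $(X,\{R_0,\dots,R_D\})$ be a symmetric association scheme of class $D\ge 2$ with adjacency matrices $A_0=I,A_1,\dots,A_D$. Suppose that it is $Q$-polynomial with respect to the ordering $E_0=\frac1{|X|}J,E_1,\dots,E_D$ of its primitive idempotents; that is, for each $0\le i\le D$ there is a real polynomial $v_i^*$ of degree $i$ such that $|X|E_i$ is obtained by applying $v_i^*$ to each entry of $|X|E_1$. Define the dual eigenvalues $\theta_h^*$ by $E_1=\frac1{|X|}\sum_{h=0}^D\theta_h^*A_h$ and the Krein parameters $q_{i,j}^h$ by $E_i\circ E_j=\frac1{|X|}\sum_{h=0}^D q_{i,j}^hE_h$, where $\circ$ is the entrywise product, and put $m=\theta_0^*$, $b_i^*=q_{1,i+1}^i$ $(0\le i\le D-1)$ and $c_i^*=q_{1,i-1}^i$ $(1\le i\le D)$. Label the relations so that $\theta_0^*\ge\theta_1^*\ge\dots\ge\theta_D^*$. Then the dual eigenvalues are distinct, $m=\theta_0^*>\theta_1^*>\dots>\theta_D^*$, and the following hold. 1. $(\theta_1^*+1)(\theta_D^*+1)\le -b_1^*$, with equality if and only if $D=2$. 2. Assume $D\ge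 3$. - If $b_2^*+c_3^*\ge m+1$, then $(\theta_1^*+1)(\theta_{D-1}^*+1)(\theta_D^*+1)\ge -b_1^*(m+1-b_2^*-c_3^*)$. - If $b_2^*+c_3^*\le m+1$, then $(\theta_1^*+1)(\theta_2^*+1)(\theta_D^*+1)\le -b_1^*(m+1-b_2^*-c_3^*)$. In either case equality holds if and only if $D=3$. -/

import Mathlib

open Matrix

/-- A symmetric association scheme of class `D` on the finite set `X`. The partition of `X × X`
into the relations `R_0, …, R_D` is given by the map that sends a pair to the index of its
relation. -/
structure AssociationScheme (X : Type*) [Fintype X] (D : ℕ) where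
  /-- `rel x y` is the index `i` with `(x, y) ∈ R_i` -/
  rel : X → X → Fin (D + 1)
  /-- every relation is non-empty -/
  rel_surj : ∀ i, ∃ x y, rel x y = i
  /-- `R_0` is the diagonal -/
  rel_eq_zero_iff : ∀ x y, rel x y = 0 ↔ x = y
  /-- every relation is symmetric -/
  rel_symm : ∀ x y, rel x y = rel y x
  /-- the intersection numbers `p_{i,j}^k` exist -/
  intersection : ∀ i j k : Fin (D + 1), ∃ p : ℕ, ∀ x y, rel x y = k →
    (Finset.univ.filter fun z => rel x z = i ∧ rel z y = j).card = p

namespace AssociationScheme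

variable {X : Type*} [Fintype X] {D : ℕ} (S : AssociationScheme X D)

/-- The adjacency matrix `A_i` of the relation `R_i`. -/
def adj (i : Fin (D + 1)) : Matrix X X ℝ :=
  Matrix.of fun x y => if S.rel x y = i then 1 else 0

/-- The Bose–Mesner algebra, as a space of matrices: the span of `A_0, …, A_D`. -/
def boseMesner : Submodule ℝ (Matrix X X ℝ) :=
  Submodule.span ℝ (Set.range S.adj)

/-- `E_0, …, E_D` are the primitive idempotents of the scheme: the non-zero, mutually orthogonal
idempotents of the Bose–Mesner algebra that sum to the identity, with `E_0 = |X|⁻¹ J`. (There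
are `D + 1` of them, so they form a basis of the algebra.) -/
structure IsPrimitiveIdempotents [DecidableEq X] (E : Fin (D + 1) → Matrix X X ℝ) : Prop where
  zero : E 0 = (1 / (Fintype.card X : ℝ)) • Matrix.of fun _ _ => 1
  mem : ∀ i, E i ∈ S.boseMesner
  ne_zero : ∀ i, E i ≠ 0
  idem : ∀ i, E i * E i = E i
  orthogonal : ∀ i j, i ≠ j → E i * E j = 0
  sum_eq_one : ∑ i, E i = 1

/-- The scheme is `Q`-polynomial with respect to the ordering `E_0, …, E_D` of its primitive
idempotents: for each `i` there is a real polynomial `v` of degree `i` such that `|X| E_i` is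
obtained by applying `v` to every entry of `|X| E_1`. -/
def IsPrimitiveIdempotents.IsQPolynomial [DecidableEq X] {S : AssociationScheme X D}
    {E : Fin (D + 1) → Matrix X X ℝ} (_hE : S.IsPrimitiveIdempotents E) : Prop :=
  ∀ i : Fin (D + 1), ∃ v : Polynomial ℝ, v.degree = ((i : ℕ) : WithBot ℕ) ∧
    ∀ x y, (Fintype.card X : ℝ) * E i x y = v.eval ((Fintype.card X : ℝ) * E 1 x y)

variable {S}

theorem card_ne_zero (S : AssociationScheme X D) : (Fintype.card X : ℝ) ≠ 0 := by
  obtain ⟨x, -, -⟩ := S.rel_surj 0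
  have : Nonempty X := ⟨x⟩
  exact_mod_cast Fintype.card_ne_zero

theorem mem_boseMesner_iff (M : Matrix X X ℝ) :
    M ∈ S.boseMesner ↔ ∃ f : Fin (D + 1) → ℝ, ∀ x y, M x y = f (S.rel x y) := by
  unfold boseMesner
  rw [Submodule.mem_span_range_iff_exists_fun]
  constructor
  · rintro ⟨c, rfl⟩
    exact ⟨c, fun x y => by simp [Matrix.sum_apply, adj]⟩
  · rintro ⟨f, hf⟩
    exact ⟨f, by ext x y; simp [Matrix.sum_apply, adj, hf]⟩

theorem hadamard_mem {M N : Matrix X X ℝ} (hM : M ∈ S.boseMesner) (hN : N ∈ S.boseMesner) :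
    M ⊙ N ∈ S.boseMesner := by
  rw [mem_boseMesner_iff] at *
  obtain ⟨f, hf⟩ := hM
  obtain ⟨g, hg⟩ := hN
  exact ⟨fun i => f i * g i, fun x y => by simp [hf, hg]⟩

section

variable [DecidableEq X] {E : Fin (D + 1) → Matrix X X ℝ}

theorem IsPrimitiveIdempotents.linearIndependent (hE : S.IsPrimitiveIdempotents E) :
    LinearIndependent ℝ E := by
  rw [Fintype.linearIndependent_iff]
  intro g hg i
  have h : (∑ j, g j • E j) * E i = g i • E i := by
    rw [Finset.sum_mul, Finset.sum_eq_single i]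
    · rw [Matrix.smul_mul, hE.idem]
    · intro j _ hj
      rw [Matrix.smul_mul, hE.orthogonal j i hj, smul_zero]
    · simp
  rw [hg, zero_mul] at h
  exact (smul_eq_zero.mp h.symm).resolve_right (hE.ne_zero i)

theorem IsPrimitiveIdempotents.span_eq (hE : S.IsPrimitiveIdempotents E) :
    Submodule.span ℝ (Set.range E) = S.boseMesner := by
  apply Submodule.eq_of_le_of_finrank_le
  · rw [Submodule.span_le]
    rintro _ ⟨i, rfl⟩
    exact hE.mem i
  · rw [finrank_span_eq_card hE.linearIndependent]
    exact finrank_range_le_card S.adj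

theorem IsPrimitiveIdempotents.exists_krein (hE : S.IsPrimitiveIdempotents E)
    (i j : Fin (D + 1)) : ∃ q : Fin (D + 1) → ℝ,
      E i ⊙ E j = (1 / (Fintype.card X : ℝ)) • ∑ h, q h • E h := by
  have h := hadamard_mem (hE.mem i) (hE.mem j)
  rw [← hE.span_eq, Submodule.mem_span_range_iff_exists_fun] at h
  obtain ⟨c, hc⟩ := h
  refine ⟨fun h => (Fintype.card X : ℝ) * c h, ?_⟩
  simp only [mul_smul, ← Finset.smul_sum]
  rw [hc, smul_smul, one_div, inv_mul_cancel₀ S.card_ne_zero, one_smul]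

theorem IsPrimitiveIdempotents.exists_dualEigenvalue (hE : S.IsPrimitiveIdempotents E) :
    ∃ θ : Fin (D + 1) → ℝ, E 1 = (1 / (Fintype.card X : ℝ)) • ∑ h, θ h • S.adj h := by
  have h := hE.mem 1
  rw [boseMesner, Submodule.mem_span_range_iff_exists_fun] at h
  obtain ⟨c, hc⟩ := h
  refine ⟨fun h => (Fintype.card X : ℝ) * c h, ?_⟩
  simp only [mul_smul, ← Finset.smul_sum]
  rw [hc, smul_smul, one_div, inv_mul_cancel₀ S.card_ne_zero, one_smul]

/-- The Krein parameter `q_{i,j}^h`: the (unique) coefficients in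
`E_i ∘ E_j = |X|⁻¹ ∑_h q_{i,j}^h E_h`, where `∘` is the entrywise product. -/
noncomputable def IsPrimitiveIdempotents.krein (hE : S.IsPrimitiveIdempotents E)
    (i j h : Fin (D + 1)) : ℝ :=
  (hE.exists_krein i j).choose h

theorem IsPrimitiveIdempotents.krein_spec (hE : S.IsPrimitiveIdempotents E)
    (i j : Fin (D + 1)) :
    E i ⊙ E j = (1 / (Fintype.card X : ℝ)) • ∑ h, hE.krein i j h • E h :=
  (hE.exists_krein i j).choose_spec

/-- The dual eigenvalue `θ*_h`: the (unique) coefficients in `E_1 = |X|⁻¹ ∑_h θ*_h A_h`. -/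
noncomputable def IsPrimitiveIdempotents.dualEigenvalue (hE : S.IsPrimitiveIdempotents E)
    (h : Fin (D + 1)) : ℝ :=
  hE.exists_dualEigenvalue.choose h

theorem IsPrimitiveIdempotents.dualEigenvalue_spec (hE : S.IsPrimitiveIdempotents E) :
    E 1 = (1 / (Fintype.card X : ℝ)) • ∑ h, hE.dualEigenvalue h • S.adj h :=
  hE.exists_dualEigenvalue.choose_spec

/-- `b*_i = q_{1,i+1}^i` for `0 ≤ i ≤ D - 1`. -/
noncomputable def IsPrimitiveIdempotents.bStar (hE : S.IsPrimitiveIdempotents E)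
    (i : ℕ) (hi : i + 1 ≤ D) : ℝ :=
  hE.krein 1 ⟨i + 1, by omega⟩ ⟨i, by omega⟩

/-- `c*_i = q_{1,i-1}^i` for `1 ≤ i ≤ D`. -/
noncomputable def IsPrimitiveIdempotents.cStar (hE : S.IsPrimitiveIdempotents E)
    (i : ℕ) (hi : 1 ≤ i ∧ i ≤ D) : ℝ :=
  hE.krein 1 ⟨i - 1, by omega⟩ ⟨i, by omega⟩

end

end AssociationScheme

/-!
Write `θ_h`, `b_i`, `c_i` without stars, and let `v_i` be the polynomial with
`|X| E_i = v_i(|X| E_1)` entrywise. The kernel polynomial `κ_n = v_0 + ⋯ + v_{n-1}` reproduces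
values at `θ_0` with respect to the masses `|R_h|` at the points `θ_h`. Hence `κ_{n+1}` is
orthogonal to all polynomials of degree less than `n` with respect to the positive masses
`|R_h| (θ_0 - θ_h)` at the points `θ_h`, `h ≠ 0`. By the Christoffel–Darboux formula the multiples
`c_2 ⋯ c_n κ_{n+1}` are, in the variable `x = θ + 1`, the monic polynomials `p_1 = x`,
`p_2 = (x - (m + 1 - b_1 - c_2)) p_1 - b_1` and
`p_3 = (x - (m + 1 - b_2 - c_3)) p_2 - c_2 b_2 p_1`.

Put `x_h = θ_h + 1`. Orthogonality of `p_1` and `p_2` to `1` says that `x` has mean zero and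
variance `b_1`, and part 1 is the nonnegativity of the mean of `(x_1 - x) (x - x_D)`. In part 2,
let `r_1 > r_2 > r_3` be the roots of `p_3`, whose product is `-b_1 (m + 1 - b_2 - c_3)`. The outer
ones lie between `x_D` and `x_1`. If `m + 1 ≥ b_2 + c_3`, then `r_2 ≥ 0`, and `r_2 ≤ x_2` because
otherwise `-(x - x_1) (x - r_3) p_3` would be nonnegative at every `x_h`; so
`x_1 x_2 x_D ≤ r_1 r_2 r_3`. The other case is the mirror image under `x ↦ -x`.
-/

section OrthogonalPolynomials

open Polynomial

variable {ι : Type*} {s : Finset ι} {w t : ι → ℝ} {n : ℕ} {p : ℝ[X]}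

/-- The polynomial `p` is orthogonal to all polynomials of degree less than `n` with respect to
the discrete measure that puts mass `w i` at the node `t i` for each `i ∈ s`. -/
def IsOrthogonalBelow (s : Finset ι) (w t : ι → ℝ) (n : ℕ) (p : ℝ[X]) : Prop :=
  ∀ q : ℝ[X], q.degree < n → ∑ i ∈ s, w i * (p.eval (t i) * q.eval (t i)) = 0

theorem mul_extreme_nodes_le {b : ℝ} {i₁ i₂ : ι} (hw : ∀ i ∈ s, 0 < w i)
    (hmean : ∑ i ∈ s, w i * t i = 0) (hvar : ∑ i ∈ s, w i * t i ^ 2 = b * ∑ i ∈ s, w i)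
    (hi₁ : i₁ ∈ s) (hle : ∀ i ∈ s, t i ≤ t i₁) (hge : ∀ i ∈ s, t i₂ ≤ t i) :
    t i₁ * t i₂ ≤ -b ∧ (t i₁ * t i₂ = -b ↔ ∀ i ∈ s, t i = t i₁ ∨ t i = t i₂) := by
  have hmass : 0 < ∑ i ∈ s, w i := Finset.sum_pos hw ⟨i₁, hi₁⟩
  have hsum : ∑ i ∈ s, w i * ((t i₁ - t i) * (t i - t i₂)) =
      (-b - t i₁ * t i₂) * ∑ i ∈ s, w i := by
    calc ∑ i ∈ s, w i * ((t i₁ - t i) * (t i - t i₂))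
        = (t i₁ + t i₂) * ∑ i ∈ s, w i * t i - ∑ i ∈ s, w i * t i ^ 2
            - t i₁ * t i₂ * ∑ i ∈ s, w i := by
          simp only [Finset.mul_sum, ← Finset.sum_sub_distrib]
          exact Finset.sum_congr rfl fun i _ => by ring
      _ = (-b - t i₁ * t i₂) * ∑ i ∈ s, w i := by
          rw [hmean, hvar]
          ring
  have hterm : ∀ i ∈ s, 0 ≤ w i * ((t i₁ - t i) * (t i - t i₂)) := fun i hi =>
    mul_nonneg (hw i hi).le (mul_nonneg (sub_nonneg.2 (hle i hi)) (sub_nonneg.2 (hge i hi)))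
  refine ⟨sub_nonneg.1 (nonneg_of_mul_nonneg_left (hsum ▸ Finset.sum_nonneg hterm) hmass), ?_⟩
  calc t i₁ * t i₂ = -b ↔ (-b - t i₁ * t i₂) * ∑ i ∈ s, w i = 0 := by
        rw [mul_eq_zero, or_iff_left hmass.ne', sub_eq_zero, eq_comm]
    _ ↔ ∀ i ∈ s, w i * ((t i₁ - t i) * (t i - t i₂)) = 0 := by
        rw [← hsum, Finset.sum_eq_zero_iff_of_nonneg hterm]
    _ ↔ ∀ i ∈ s, t i = t i₁ ∨ t i = t i₂ := forall₂_congr fun i hi => by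
        rw [mul_eq_zero, or_iff_right (hw i hi).ne', mul_eq_zero, sub_eq_zero, sub_eq_zero,
          eq_comm]

namespace IsOrthogonalBelow

theorem eval_mul_eval_eq_zero (hp : IsOrthogonalBelow s w t n p) (hw : ∀ i ∈ s, 0 < w i)
    {q : ℝ[X]} (hq : q.degree < n) (hpq : ∀ i ∈ s, 0 ≤ p.eval (t i) * q.eval (t i)) :
    ∀ i ∈ s, p.eval (t i) * q.eval (t i) = 0 := fun i hi =>
  have hterm := (Finset.sum_eq_zero_iff_of_nonneg fun j hj =>
    mul_nonneg (hw j hj).le (hpq j hj)).1 (hp q hq) i hi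
  (mul_eq_zero.1 hterm).resolve_left (hw i hi).ne'

theorem neg_nodes (hp : IsOrthogonalBelow s w t n p) :
    IsOrthogonalBelow s w (-t) n (-p.comp (-X)) := by
  intro q hq
  have hdeg : (-q.comp (-X)).degree < n := by
    simpa using hq
  simpa using hp _ hdeg

theorem eval_node_eq_zero (hp : IsOrthogonalBelow s w t n p) (hw : ∀ i ∈ s, 0 < w i)
    {q : ℝ[X]} (hq : q.degree < n) {j : ι} (hj : j ∈ s) (hqj : q.eval (t j) ≠ 0)
    (hq_zero : ∀ i ∈ s, t i ≠ t j → q.eval (t i) = 0) : p.eval (t j) = 0 := by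
  let q' := (p.eval (t j) * q.eval (t j)) • q
  have hq' : q'.degree < n := (degree_smul_le _ _).trans_lt hq
  have hnonneg : ∀ i ∈ s, 0 ≤ p.eval (t i) * q'.eval (t i) := by
    intro i hi
    by_cases hij : t i = t j
    · have hsq : p.eval (t i) * q'.eval (t i) = (p.eval (t j) * q.eval (t j)) ^ 2 := by
        simp only [q', eval_smul, smul_eq_mul, hij]
        ring
      exact hsq ▸ sq_nonneg _
    · simp [q', hq_zero i hi hij]
  have hzero := hp.eval_mul_eval_eq_zero hw hq' hnonneg j hj
  simpa [q', hqj] using hzero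

theorem exists_node_le_root {r : ℝ} {g : ℝ[X]}
    (hp : IsOrthogonalBelow s w t n ((X - C r) * g)) (hw : ∀ i ∈ s, 0 < w i) (hg : g ≠ 0)
    (hdeg : g.degree < n) (hn : n ≤ (s.image t).card) : ∃ i ∈ s, t i ≤ r := by
  by_contra! hlt
  have hsq : ∀ i, ((X - C r) * g).eval (t i) * g.eval (t i) = (t i - r) * g.eval (t i) ^ 2 :=
    fun i => by simp only [eval_mul, eval_sub, eval_X, eval_C]; ring
  have hzero := hp.eval_mul_eval_eq_zero hw hdeg fun i hi => by
    rw [hsq]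
    exact mul_nonneg (sub_pos.2 (hlt i hi)).le (sq_nonneg _)
  refine hg (eq_zero_of_degree_lt_of_eval_finset_eq_zero (s.image t)
    (hdeg.trans_le (by exact_mod_cast hn)) (Finset.forall_mem_image.2 fun i hi => ?_))
  have hi_zero := hzero i hi
  rw [hsq] at hi_zero
  simpa [(sub_pos.2 (hlt i hi)).ne'] using hi_zero

theorem exists_root_le_node {r : ℝ} {g : ℝ[X]}
    (hp : IsOrthogonalBelow s w t n ((X - C r) * g)) (hw : ∀ i ∈ s, 0 < w i) (hg : g ≠ 0)
    (hdeg : g.degree < n) (hn : n ≤ (s.image t).card) : ∃ i ∈ s, r ≤ t i := by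
  have hp' : IsOrthogonalBelow s w (-t) n ((X - C (-r)) * g.comp (-X)) := by
    convert hp.neg_nodes using 1
    simp only [mul_comp, sub_comp, X_comp, C_comp, C_neg]
    ring
  have hcard : (s.image (-t)).card = (s.image t).card := by
    rw [← Finset.card_image_of_injective (s.image t) neg_injective, Finset.image_image]
    rfl
  obtain ⟨i, hi, hle⟩ := hp'.exists_node_le_root hw (by simpa using hg) (by simpa using hdeg)
    (hn.trans_eq hcard.symm)
  exact ⟨i, hi, neg_le_neg_iff.1 hle⟩

section Cubic

variable {r₁ r₂ r₃ : ℝ} {i₁ i₂ i₃ : ι}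

theorem eq_or_eq_of_le_middle_root
    (hp : IsOrthogonalBelow s w t 3 ((X - C r₁) * ((X - C r₂) * (X - C r₃))))
    (hw : ∀ i ∈ s, 0 < w i) (hr₂₁ : r₂ < r₁) (h₁ : r₁ ≤ t i₁)
    (hle : ∀ i ∈ s, t i = t i₁ ∨ t i ≤ r₂) {i : ι} (hi : i ∈ s) :
    t i = t i₁ ∨ t i = r₂ ∨ t i = r₃ := by
  have hdeg : (-((X - C (t i₁)) * (X - C r₃))).degree < ((3 : ℕ) : WithBot ℕ) := by
    rw [degree_neg, degree_mul, degree_X_sub_C, degree_X_sub_C]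
    decide
  have heval : ∀ x, ((X - C r₁) * ((X - C r₂) * (X - C r₃))).eval x *
      (-((X - C (t i₁)) * (X - C r₃))).eval x =
        (t i₁ - x) * (r₁ - x) * (r₂ - x) * (x - r₃) ^ 2 := fun x => by
    simp only [eval_mul, eval_neg, eval_sub, eval_X, eval_C]
    ring
  have hzero := hp.eval_mul_eval_eq_zero hw hdeg (fun j hj => ?_) i hi
  · rw [heval] at hzero
    obtain h | h := hle i hi
    · exact Or.inl h
    · simp only [mul_eq_zero, sub_eq_zero, pow_eq_zero_iff two_ne_zero] at hzero
      grind
  · rw [heval]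
    obtain h | h := hle j hj
    · simp [h]
    · exact mul_nonneg (mul_nonneg (mul_nonneg (by linarith) (by linarith)) (by linarith))
        (sq_nonneg _)

theorem eq_roots_of_three_nodes
    (hp : IsOrthogonalBelow s w t 3 ((X - C r₁) * ((X - C r₂) * (X - C r₃))))
    (hw : ∀ i ∈ s, 0 < w i) (hr₃₂ : r₃ < r₂) (hr₂₁ : r₂ < r₁) (hi₁ : i₁ ∈ s) (hi₂ : i₂ ∈ s)
    (hi₃ : i₃ ∈ s) (h₂₁ : t i₂ < t i₁) (h₃₂ : t i₃ < t i₂)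
    (hall : ∀ i ∈ s, t i = t i₁ ∨ t i = t i₂ ∨ t i = t i₃) :
    t i₁ = r₁ ∧ t i₂ = r₂ ∧ t i₃ = r₃ := by
  have hroot : ∀ j ∈ s, ∀ y z : ℝ, t j ≠ y → t j ≠ z →
      (∀ i ∈ s, t i ≠ t j → t i = y ∨ t i = z) → t j = r₁ ∨ t j = r₂ ∨ t j = r₃ := by
    intro j hj y z hy hz hyz
    have hdeg : ((X - C y) * (X - C z)).degree < ((3 : ℕ) : WithBot ℕ) := by
      rw [degree_mul, degree_X_sub_C, degree_X_sub_C]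
      decide
    have hzero := hp.eval_node_eq_zero hw hdeg hj (by simp [sub_eq_zero, hy, hz])
      fun i hi hij => by simpa [sub_eq_zero] using hyz i hi hij
    simpa [sub_eq_zero] using hzero
  have h₁ := hroot i₁ hi₁ (t i₂) (t i₃) h₂₁.ne' (h₃₂.trans h₂₁).ne' (by grind)
  have h₂ := hroot i₂ hi₂ (t i₁) (t i₃) h₂₁.ne h₃₂.ne' (by grind)
  have h₃ := hroot i₃ hi₃ (t i₁) (t i₂) (h₃₂.trans h₂₁).ne h₃₂.ne (by grind)
  grind

theorem mul_three_nodes_le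
    (hp : IsOrthogonalBelow s w t 3 ((X - C r₁) * ((X - C r₂) * (X - C r₃))))
    (hw : ∀ i ∈ s, 0 < w i) (hr₃₂ : r₃ < r₂) (hr₂₁ : r₂ < r₁) (hr₃ : r₃ < 0) (hr₂ : 0 ≤ r₂)
    (hi₁ : i₁ ∈ s) (hi₂ : i₂ ∈ s) (hi₃ : i₃ ∈ s) (h₂₁ : t i₂ < t i₁) (h₃₂ : t i₃ < t i₂)
    (hle : ∀ i ∈ s, t i = t i₁ ∨ t i ≤ t i₂) (hge : ∀ i ∈ s, t i₃ ≤ t i) :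
    t i₁ * t i₂ * t i₃ ≤ r₁ * r₂ * r₃ ∧
      (t i₁ * t i₂ * t i₃ = r₁ * r₂ * r₃ ↔ ∀ i ∈ s, t i = t i₁ ∨ t i = t i₂ ∨ t i = t i₃) := by
  have hcard : 3 ≤ (s.image t).card := by
    rw [← Finset.card_eq_three.2 ⟨t i₁, t i₂, t i₃, h₂₁.ne', (h₃₂.trans h₂₁).ne', h₃₂.ne', rfl⟩]
    exact Finset.card_le_card (by grind)
  have hdeg : ∀ y z : ℝ, ((X - C y) * (X - C z)).degree < ((3 : ℕ) : WithBot ℕ) := fun y z => by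
    rw [degree_mul, degree_X_sub_C, degree_X_sub_C]
    decide
  have hne : ∀ y z : ℝ, (X - C y) * (X - C z) ≠ 0 := fun y z =>
    mul_ne_zero (X_sub_C_ne_zero y) (X_sub_C_ne_zero z)
  have hr₁t : r₁ ≤ t i₁ := by
    obtain ⟨i, hi, hri⟩ := hp.exists_root_le_node hw (hne _ _) (hdeg _ _) hcard
    grind
  have hr₃t : t i₃ ≤ r₃ := by
    rw [← mul_assoc, mul_comm] at hp
    obtain ⟨i, hi, hri⟩ := hp.exists_node_le_root hw (hne _ _) (hdeg _ _) hcard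
    exact (hge i hi).trans hri
  have hnodes : t i₂ ≤ r₂ → ∀ i ∈ s, t i = t i₁ ∨ t i = r₂ ∨ t i = r₃ := fun h i hi =>
    hp.eq_or_eq_of_le_middle_root hw hr₂₁ hr₁t (fun j hj => (hle j hj).imp_right h.trans') hi
  have hr₂t : r₂ ≤ t i₂ := by
    by_contra! hlt
    have h₂ := hnodes hlt.le i₂ hi₂
    have h₃ := hnodes hlt.le i₃ hi₃
    grind
  have hprod : r₁ * r₂ ≤ t i₁ * t i₂ :=
    mul_le_mul hr₁t hr₂t hr₂ (by linarith)
  have hprod_nonneg : 0 ≤ r₁ * r₂ := mul_nonneg (by linarith) hr₂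
  refine ⟨by nlinarith, fun heq => ?_, fun hall => ?_⟩
  · have h₂ : t i₂ ≤ r₂ := by
      by_contra! hlt
      have hprod_lt : r₁ * r₂ < t i₁ * t i₂ := by nlinarith
      nlinarith
    have h₃ := hnodes h₂ i₃ hi₃
    intro i hi
    have := hnodes h₂ i hi
    grind
  · obtain ⟨e₁, e₂, e₃⟩ := hp.eq_roots_of_three_nodes hw hr₃₂ hr₂₁ hi₁ hi₂ hi₃ h₂₁ h₃₂ hall
    rw [e₁, e₂, e₃]

end Cubic

end IsOrthogonalBelow

theorem exists_root_gt {z : ℝ} (hdeg : 0 < p.degree) (hlead : 0 ≤ p.leadingCoeff)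
    (hz : p.eval z < 0) : ∃ r, z < r ∧ p.eval r = 0 := by
  obtain ⟨y, hy, hzy⟩ := (((p.tendsto_atTop_of_leadingCoeff_nonneg hdeg hlead).eventually_gt_atTop
    0).and (Filter.eventually_gt_atTop z)).exists
  obtain ⟨r, hr, hr_root⟩ := intermediate_value_Ioo hzy.le p.continuousOn ⟨hz, hy⟩
  exact ⟨r, hr.1, hr_root⟩

theorem exists_root_lt_of_odd {y : ℝ} (hodd : Odd p.natDegree) (hlead : 0 ≤ p.leadingCoeff)
    (hy : 0 < p.eval y) : ∃ r, r < y ∧ p.eval r = 0 := by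
  have hlead' : (-p.comp (-X)).leadingCoeff = p.leadingCoeff := by
    simp [leadingCoeff_comp, hodd.neg_one_pow]
  obtain ⟨r, hr, hr_root⟩ := exists_root_gt (p := -p.comp (-X)) (z := -y)
    (by simpa using natDegree_pos_iff_degree_pos.1 hodd.pos) (hlead' ▸ hlead) (by simpa using hy)
  exact ⟨-r, neg_lt.1 hr, by simpa using hr_root⟩

theorem exists_cubic_eq_mul (hp : p.Monic) (hdeg : p.natDegree = 3) {y z : ℝ}
    (hyz : y < z) (hy : 0 < p.eval y) (hz : p.eval z < 0) :
    ∃ r₁ r₂ r₃, r₃ < y ∧ r₃ < r₂ ∧ r₂ < r₁ ∧ z < r₁ ∧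
      p = (X - C r₁) * ((X - C r₂) * (X - C r₃)) := by
  obtain ⟨r₁, hr₁, h₁⟩ := exists_root_gt (natDegree_pos_iff_degree_pos.1 (by omega))
    (by simp [hp.leadingCoeff]) hz
  obtain ⟨r₂, ⟨hr₂y, hr₂z⟩, h₂⟩ := intermediate_value_Ioo' hyz.le p.continuousOn ⟨hz, hy⟩
  obtain ⟨r₃, hr₃, h₃⟩ := exists_root_lt_of_odd (hdeg ▸ by decide) (by simp [hp.leadingCoeff]) hy
  refine ⟨r₁, r₂, r₃, hr₃, hr₃.trans hr₂y, hr₂z.trans hr₁, hr₁, ?_⟩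
  have hq : ((X - C r₁) * ((X - C r₂) * (X - C r₃))).Monic :=
    (monic_X_sub_C _).mul ((monic_X_sub_C _).mul (monic_X_sub_C _))
  have hcard : ({r₁, r₂, r₃} : Finset ℝ).card = 3 :=
    Finset.card_eq_three.2 ⟨r₁, r₂, r₃, by grind⟩
  have hdeg_eq : p.degree = ((X - C r₁) * ((X - C r₂) * (X - C r₃))).degree := by
    rw [degree_mul, degree_mul, degree_X_sub_C, degree_X_sub_C, degree_X_sub_C,
      degree_eq_natDegree hp.ne_zero, hdeg]
    decide
  refine eq_of_degree_sub_lt_of_eval_finset_eq {r₁, r₂, r₃} ?_ (by simp [*])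
  rw [hcard]
  exact (degree_sub_lt_left hdeg_eq hp.ne_zero (by rw [hp.leadingCoeff, hq.leadingCoeff])).trans_eq
    (by rw [degree_eq_natDegree hp.ne_zero, hdeg])

/-- The monic cubic `p₃` of the three-term recurrence `p₁ = X`, `p₂ = (X - a) p₁ - b`,
`p₃ = (X - c) p₂ - β p₁`. -/
noncomputable def recurrenceCubic (a b c β : ℝ) : ℝ[X] :=
  (X - C c) * (X ^ 2 - C a * X - C b) - C β * X

section RecurrenceCubic

variable {a b c β : ℝ}

theorem monic_recurrenceCubic : (recurrenceCubic a b c β).Monic := by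
  unfold recurrenceCubic
  monicity!

theorem natDegree_recurrenceCubic : (recurrenceCubic a b c β).natDegree = 3 := by
  unfold recurrenceCubic
  compute_degree!

theorem exists_recurrenceCubic_eq_mul (hb : 0 < b) (hβ : 0 < β) :
    ∃ r₁ r₂ r₃, r₃ < 0 ∧ r₃ < r₂ ∧ r₂ < r₁ ∧ 0 < r₁ ∧ r₁ * r₂ * r₃ = -b * c ∧
      recurrenceCubic a b c β = (X - C r₁) * ((X - C r₂) * (X - C r₃)) := by
  -- At the two roots of `p₂`, which have opposite signs, `p₃ = -β X`.
  obtain ⟨y, z, hy, hz, hroot⟩ : ∃ y z : ℝ, y < 0 ∧ 0 < z ∧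
      ∀ x ∈ ({y, z} : Set ℝ), x ^ 2 - a * x - b = 0 := by
    have hsqrt := Real.sq_sqrt (show 0 ≤ a ^ 2 + 4 * b by positivity)
    have habs : |a| < √(a ^ 2 + 4 * b) := Real.lt_sqrt_of_sq_lt (by rw [sq_abs]; linarith)
    rw [abs_lt] at habs
    exact ⟨(a - √(a ^ 2 + 4 * b)) / 2, (a + √(a ^ 2 + 4 * b)) / 2, by linarith, by linarith, by
      rintro x (rfl | rfl) <;> linear_combination hsqrt / 4⟩
  have heval : ∀ x, x ^ 2 - a * x - b = 0 → (recurrenceCubic a b c β).eval x = -(β * x) :=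
    fun x hx => by simp [recurrenceCubic, hx]
  obtain ⟨r₁, r₂, r₃, hr₃, hr₃₂, hr₂₁, hr₁, heq⟩ :=
    exists_cubic_eq_mul monic_recurrenceCubic natDegree_recurrenceCubic (hy.trans hz)
      (by rw [heval y (hroot y (by simp))]; nlinarith)
      (by rw [heval z (hroot z (by simp))]; nlinarith)
  refine ⟨r₁, r₂, r₃, hr₃.trans hy, hr₃₂, hr₂₁, hz.trans hr₁, ?_, heq⟩
  have hzero := congr_arg (eval 0) heq
  simp only [recurrenceCubic, eval_sub, eval_mul, eval_pow, eval_X, eval_C] at hzero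
  linarith

variable {i₁ i₂ i₃ : ι}

theorem IsOrthogonalBelow.mul_three_nodes_le_of_nonneg
    (hp : IsOrthogonalBelow s w t 3 (recurrenceCubic a b c β)) (hw : ∀ i ∈ s, 0 < w i)
    (hb : 0 < b) (hβ : 0 < β) (hc : 0 ≤ c)
    (hi₁ : i₁ ∈ s) (hi₂ : i₂ ∈ s) (hi₃ : i₃ ∈ s) (h₂₁ : t i₂ < t i₁) (h₃₂ : t i₃ < t i₂)
    (hle : ∀ i ∈ s, t i = t i₁ ∨ t i ≤ t i₂) (hge : ∀ i ∈ s, t i₃ ≤ t i) :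
    t i₁ * t i₂ * t i₃ ≤ -b * c ∧
      (t i₁ * t i₂ * t i₃ = -b * c ↔ ∀ i ∈ s, t i = t i₁ ∨ t i = t i₂ ∨ t i = t i₃) := by
  obtain ⟨r₁, r₂, r₃, hr₃, hr₃₂, hr₂₁, hr₁, hprod, heq⟩ :=
    exists_recurrenceCubic_eq_mul (a := a) (c := c) hb hβ
  have hr₂ : 0 ≤ r₂ := by
    by_contra! hneg
    have hpos : 0 < r₁ * r₂ * r₃ := mul_pos_of_neg_of_neg (mul_neg_of_pos_of_neg hr₁ hneg) hr₃
    nlinarith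
  rw [← hprod]
  exact (heq ▸ hp).mul_three_nodes_le hw hr₃₂ hr₂₁ hr₃ hr₂ hi₁ hi₂ hi₃ h₂₁ h₃₂ hle hge

theorem IsOrthogonalBelow.le_mul_three_nodes_of_nonpos
    (hp : IsOrthogonalBelow s w t 3 (recurrenceCubic a b c β)) (hw : ∀ i ∈ s, 0 < w i)
    (hb : 0 < b) (hβ : 0 < β) (hc : c ≤ 0)
    (hi₁ : i₁ ∈ s) (hi₂ : i₂ ∈ s) (hi₃ : i₃ ∈ s) (h₂₁ : t i₂ < t i₁) (h₃₂ : t i₃ < t i₂)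
    (hle : ∀ i ∈ s, t i ≤ t i₁) (hge : ∀ i ∈ s, t i = t i₃ ∨ t i₂ ≤ t i) :
    -b * c ≤ t i₁ * t i₂ * t i₃ ∧
      (t i₁ * t i₂ * t i₃ = -b * c ↔ ∀ i ∈ s, t i = t i₁ ∨ t i = t i₂ ∨ t i = t i₃) := by
  have hp' : IsOrthogonalBelow s w (-t) 3 (recurrenceCubic (-a) b (-c) β) := by
    convert hp.neg_nodes using 1
    simp only [recurrenceCubic, sub_comp, mul_comp, pow_comp, X_comp, C_comp, C_neg]
    ring
  obtain ⟨hprod, heq⟩ := hp'.mul_three_nodes_le_of_nonneg hw hb hβ (neg_nonneg.2 hc) hi₃ hi₂ hi₁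
    (neg_lt_neg h₃₂) (neg_lt_neg h₂₁) (fun i hi => (hge i hi).imp (congr_arg Neg.neg) neg_le_neg)
    fun i hi => neg_le_neg (hle i hi)
  have hneg : (-t) i₃ * (-t) i₂ * (-t) i₁ = -(t i₁ * t i₂ * t i₃) := by
    simp only [Pi.neg_apply]
    ring
  rw [hneg] at hprod heq
  refine ⟨by linarith, ?_⟩
  calc t i₁ * t i₂ * t i₃ = -b * c ↔ -(t i₁ * t i₂ * t i₃) = -b * -c := by
        rw [mul_neg, neg_inj]
    _ ↔ ∀ i ∈ s, t i = t i₁ ∨ t i = t i₂ ∨ t i = t i₃ := by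
        rw [heq]
        simp only [Pi.neg_apply, neg_inj]
        grind

end RecurrenceCubic

end OrthogonalPolynomials

theorem forall_pos_eq_or_eq_or_eq_last_iff {D : ℕ} {i : Fin (D + 1)} (hi : 1 < (i : ℕ))
    (hiD : (i : ℕ) < D) :
    (∀ h : Fin (D + 1), 0 < h → h = ⟨1, by omega⟩ ∨ h = i ∨ h = Fin.last D) ↔ D = 3 := by
  simp only [Fin.ext_iff, Fin.lt_def, Fin.val_last, Fin.val_zero]
  refine ⟨fun hall => ?_, fun hD h hh => by omega⟩
  have htwo : 2 = 1 ∨ 2 = (i : ℕ) ∨ 2 = D := hall ⟨2, by omega⟩ Nat.two_pos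
  have hpred : D - 1 = 1 ∨ D - 1 = (i : ℕ) ∨ D - 1 = D :=
    hall ⟨D - 1, by omega⟩ (show 0 < D - 1 by omega)
  omega

namespace AssociationScheme

variable {X : Type*} [Fintype X] {D : ℕ} {S : AssociationScheme X D}

/-- The number of ordered pairs in the relation `R_h`. -/
def numPairs (S : AssociationScheme X D) (h : Fin (D + 1)) : ℕ :=
  (Finset.univ.filter fun p : X × X => S.rel p.1 p.2 = h).card

theorem sum_numPairs_mul (f : Fin (D + 1) → ℝ) :
    ∑ h, S.numPairs h * f h = ∑ x, ∑ y, f (S.rel x y) := by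
  rw [← Fintype.sum_prod_type', ← Finset.sum_fiberwise' Finset.univ fun p : X × X => S.rel p.1 p.2]
  exact Finset.sum_congr rfl fun h _ => by rw [Finset.sum_const, nsmul_eq_mul]; rfl

theorem numPairs_pos (S : AssociationScheme X D) (h : Fin (D + 1)) : 0 < S.numPairs h := by
  obtain ⟨x, y, hxy⟩ := S.rel_surj h
  exact Finset.card_pos.2 ⟨(x, y), by simpa using hxy⟩

theorem card_pos (S : AssociationScheme X D) : 0 < (Fintype.card X : ℝ) :=
  S.card_ne_zero.symm.lt_of_le (Nat.cast_nonneg _)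

namespace IsPrimitiveIdempotents

variable [DecidableEq X] {E : Fin (D + 1) → Matrix X X ℝ}

/-- The entry `Q_{h,i}` of the second eigenmatrix `Q` of the scheme, which expresses the idempotents
through the adjacency matrices: `|X| E_i = ∑_h Q_{h,i} A_h`. -/
noncomputable def dualEigenmatrix (hE : S.IsPrimitiveIdempotents E) (i h : Fin (D + 1)) : ℝ :=
  (Fintype.card X : ℝ) * ((mem_boseMesner_iff (E i)).1 (hE.mem i)).choose h

variable (hE : S.IsPrimitiveIdempotents E)

theorem dualEigenmatrix_rel (i : Fin (D + 1)) (x y : X) :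
    hE.dualEigenmatrix i (S.rel x y) = (Fintype.card X : ℝ) * E i x y := by
  rw [((mem_boseMesner_iff (E i)).1 (hE.mem i)).choose_spec x y, dualEigenmatrix]

theorem dualEigenmatrix_zero_left (h : Fin (D + 1)) : hE.dualEigenmatrix 0 h = 1 := by
  obtain ⟨x, y, rfl⟩ := S.rel_surj h
  simp [dualEigenmatrix_rel, hE.zero, S.card_ne_zero]

theorem dualEigenmatrix_one (h : Fin (D + 1)) :
    hE.dualEigenmatrix 1 h = hE.dualEigenvalue h := by
  obtain ⟨x, y, rfl⟩ := S.rel_surj h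
  rw [dualEigenmatrix_rel, hE.dualEigenvalue_spec]
  simp [Matrix.sum_apply, adj, S.card_ne_zero]

theorem dualEigenmatrix_zero_right (i : Fin (D + 1)) : hE.dualEigenmatrix i 0 = (E i).trace := by
  have hdiag : ∀ x, (Fintype.card X : ℝ) * E i x x = hE.dualEigenmatrix i 0 := fun x => by
    rw [← dualEigenmatrix_rel, (S.rel_eq_zero_iff x x).2 rfl]
  refine mul_left_cancel₀ S.card_ne_zero ?_
  simp only [trace, diag_apply, Finset.mul_sum, hdiag]
  rw [Finset.sum_const, nsmul_eq_mul, Finset.card_univ]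

include hE in
theorem conjTranspose_eq (i : Fin (D + 1)) : (E i)ᴴ = E i := by
  ext x y
  refine mul_left_cancel₀ S.card_ne_zero ?_
  rw [conjTranspose_apply, star_trivial, ← hE.dualEigenmatrix_rel, ← hE.dualEigenmatrix_rel,
    S.rel_symm]

include hE in
theorem posSemidef (i : Fin (D + 1)) : (E i).PosSemidef := by
  have hsq := posSemidef_conjTranspose_mul_self (E i)
  rwa [hE.conjTranspose_eq, hE.idem] at hsq

theorem dualEigenmatrix_zero_right_pos (i : Fin (D + 1)) : 0 < hE.dualEigenmatrix i 0 := by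
  rw [dualEigenmatrix_zero_right]
  exact (hE.posSemidef i).trace_nonneg.lt_of_ne'
    (mt (hE.posSemidef i).trace_eq_zero_iff.1 (hE.ne_zero i))

theorem sum_dualEigenmatrix_mul (i j : Fin (D + 1)) :
    ∑ h, S.numPairs h * (hE.dualEigenmatrix i h * hE.dualEigenmatrix j h) =
      if i = j then (Fintype.card X : ℝ) ^ 2 * hE.dualEigenmatrix j 0 else 0 := by
  have htrace : ∑ h, S.numPairs h * (hE.dualEigenmatrix i h * hE.dualEigenmatrix j h) =
      (Fintype.card X : ℝ) ^ 2 * (E i * E j).trace := by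
    conv_rhs => rw [← hE.conjTranspose_eq j]
    simp only [sum_numPairs_mul, dualEigenmatrix_rel, trace, diag_apply, mul_apply,
      conjTranspose_apply, star_trivial, Finset.mul_sum]
    exact Finset.sum_congr rfl fun x _ => Finset.sum_congr rfl fun y _ => by ring
  rw [htrace]
  split_ifs with hij
  · rw [hij, hE.idem, dualEigenmatrix_zero_right]
  · rw [hE.orthogonal i j hij, trace_zero, mul_zero]

theorem dualEigenmatrix_mul (i j h : Fin (D + 1)) :
    hE.dualEigenmatrix i h * hE.dualEigenmatrix j h =
      ∑ l, hE.krein i j l * hE.dualEigenmatrix l h := by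
  obtain ⟨x, y, rfl⟩ := S.rel_surj h
  have hentry := congr_fun₂ (hE.krein_spec i j) x y
  simp only [hadamard_apply, Matrix.smul_apply, Matrix.sum_apply, smul_eq_mul] at hentry
  simp only [dualEigenmatrix_rel, mul_left_comm _ (Fintype.card X : ℝ), ← Finset.mul_sum]
  rw [mul_assoc, hentry, one_div, mul_inv_cancel_left₀ S.card_ne_zero]

theorem sum_dualEigenmatrix_mul_mul (i j l : Fin (D + 1)) :
    ∑ h, S.numPairs h * (hE.dualEigenmatrix i h * hE.dualEigenmatrix j h *
      hE.dualEigenmatrix l h) =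
        (Fintype.card X : ℝ) ^ 2 * (hE.krein i j l * hE.dualEigenmatrix l 0) := by
  calc ∑ h, S.numPairs h * (hE.dualEigenmatrix i h * hE.dualEigenmatrix j h *
        hE.dualEigenmatrix l h)
      = ∑ p, hE.krein i j p * ∑ h, S.numPairs h *
          (hE.dualEigenmatrix p h * hE.dualEigenmatrix l h) := by
        simp only [hE.dualEigenmatrix_mul i j, Finset.sum_mul, Finset.mul_sum]
        rw [Finset.sum_comm]
        exact Finset.sum_congr rfl fun p _ => Finset.sum_congr rfl fun h _ => by ring
    _ = (Fintype.card X : ℝ) ^ 2 * (hE.krein i j l * hE.dualEigenmatrix l 0) := by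
        simp [sum_dualEigenmatrix_mul, mul_left_comm]

theorem krein_mul_dualEigenmatrix (i j l : Fin (D + 1)) :
    hE.krein i j l * hE.dualEigenmatrix l 0 = hE.krein i l j * hE.dualEigenmatrix j 0 := by
  refine mul_left_cancel₀ (pow_ne_zero 2 S.card_ne_zero) ?_
  rw [← sum_dualEigenmatrix_mul_mul, ← sum_dualEigenmatrix_mul_mul]
  simp only [mul_right_comm]

theorem sum_krein (i l : Fin (D + 1)) : ∑ j, hE.krein i j l = hE.dualEigenmatrix i 0 := by
  refine mul_right_cancel₀ (hE.dualEigenmatrix_zero_right_pos l).ne' ?_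
  rw [dualEigenmatrix_mul, Finset.sum_mul]
  exact Finset.sum_congr rfl fun j _ => hE.krein_mul_dualEigenmatrix i j l

theorem krein_nonneg (i j l : Fin (D + 1)) : 0 ≤ hE.krein i j l := by
  have hcompress : E l * (E i ⊙ E j) * (E l)ᴴ = (hE.krein i j l / Fintype.card X) • E l := by
    rw [hE.krein_spec, hE.conjTranspose_eq, Matrix.mul_smul, Matrix.smul_mul, Matrix.mul_sum,
      Matrix.sum_mul, Finset.sum_eq_single l]
    · rw [Matrix.mul_smul, Matrix.smul_mul, hE.idem, hE.idem, smul_smul, one_div_mul_eq_div]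
    · intro h _ hhl
      rw [Matrix.mul_smul, hE.orthogonal l h hhl.symm, smul_zero, zero_mul]
    · simp
  have hpos := ((hE.posSemidef i).hadamard (hE.posSemidef j)).mul_mul_conjTranspose_same (E l)
  have htrace := hpos.trace_nonneg
  rw [hcompress, trace_smul, ← hE.dualEigenmatrix_zero_right, smul_eq_mul] at htrace
  have hdiv := nonneg_of_mul_nonneg_left htrace (hE.dualEigenmatrix_zero_right_pos l)
  rwa [le_div_iff₀ S.card_pos, zero_mul] at hdiv

/-- The polynomial `v_0 + ⋯ + v_{n-1}` in the dual eigenvalue `θ_h`. It is the kernel that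
reproduces the value at `θ_0` of the polynomials of degree less than `n`, for the measure that puts
mass `|R_h|` at `θ_h`, up to the factor `|X|²`. -/
noncomputable def kernel (hE : S.IsPrimitiveIdempotents E) (n : ℕ) (h : Fin (D + 1)) : ℝ :=
  ∑ j ∈ Finset.univ.filter fun j : Fin (D + 1) => (j : ℕ) < n, hE.dualEigenmatrix j h

theorem kernel_succ {n : ℕ} (hn : n ≤ D) (h : Fin (D + 1)) :
    hE.kernel (n + 1) h = hE.kernel n h + hE.dualEigenmatrix ⟨n, by omega⟩ h := by
  have hinsert : Finset.univ.filter (fun j : Fin (D + 1) => (j : ℕ) < n + 1) =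
      insert ⟨n, by omega⟩ (Finset.univ.filter fun j : Fin (D + 1) => (j : ℕ) < n) := by
    ext j
    simp only [Finset.mem_filter_univ, Finset.mem_insert, Fin.ext_iff]
    omega
  rw [kernel, hinsert, Finset.sum_insert (by simp), add_comm, kernel]

theorem kernel_one (h : Fin (D + 1)) : hE.kernel 1 h = 1 := by
  rw [hE.kernel_succ (Nat.zero_le D), kernel, Fin.zero_eta, dualEigenmatrix_zero_left]
  simp

theorem kernel_two (hD : 1 ≤ D) (h : Fin (D + 1)) :
    hE.kernel 2 h = hE.dualEigenvalue h + 1 := by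
  have hone : (⟨1, by omega⟩ : Fin (D + 1)) = 1 := Fin.ext (Nat.mod_eq_of_lt (by omega)).symm
  rw [hE.kernel_succ hD, kernel_one, hone, dualEigenmatrix_one, add_comm]

theorem kernel_zero_right_pos {n : ℕ} (hn : 0 < n) : 0 < hE.kernel n 0 :=
  Finset.sum_pos (fun j _ => hE.dualEigenmatrix_zero_right_pos j) ⟨0, by simpa using hn⟩

theorem sum_kernel_mul_dualEigenmatrix (n : ℕ) (j : Fin (D + 1)) :
    ∑ h, S.numPairs h * (hE.kernel n h * hE.dualEigenmatrix j h) =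
      if (j : ℕ) < n then (Fintype.card X : ℝ) ^ 2 * hE.dualEigenmatrix j 0 else 0 := by
  simp only [kernel, Finset.sum_mul, Finset.mul_sum]
  rw [Finset.sum_comm]
  simp [sum_dualEigenmatrix_mul]

/-- The weights `|R_h| (θ_0 - θ_h)` of the measure on the numbers `θ_h + 1` with `h ≠ 0` for which
the kernel polynomials are orthogonal. -/
noncomputable def weight (hE : S.IsPrimitiveIdempotents E) (h : Fin (D + 1)) : ℝ :=
  S.numPairs h * (hE.dualEigenvalue 0 - hE.dualEigenvalue h)

theorem weight_pos (hθ : StrictAnti hE.dualEigenvalue) {h : Fin (D + 1)}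
    (hh : h ∈ Finset.Ioi 0) : 0 < hE.weight h :=
  mul_pos (Nat.cast_pos.2 (S.numPairs_pos h)) (sub_pos.2 (hθ (Finset.mem_Ioi.1 hh)))

namespace IsQPolynomial

open Polynomial

variable {hE} (hQ : hE.IsQPolynomial)

include hQ

theorem exists_sequence : ∃ v : Polynomial.Sequence ℝ, ∀ (i h : Fin (D + 1)),
    hE.dualEigenmatrix i h = (v i).eval (hE.dualEigenvalue h) := by
  choose v hv_degree hv using hQ
  refine ⟨⟨fun n => if hn : n < D + 1 then v ⟨n, hn⟩ else Polynomial.X ^ n, fun n => ?_⟩,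
    fun i h => ?_⟩
  · split_ifs with hn
    · exact hv_degree ⟨n, hn⟩
    · exact degree_X_pow n
  · obtain ⟨x, y, rfl⟩ := S.rel_surj h
    rw [← dualEigenmatrix_one, dualEigenmatrix_rel, dualEigenmatrix_rel, hv]
    change _ = eval _ (if hn : (i : ℕ) < D + 1 then v ⟨i, hn⟩ else _)
    rw [dif_pos i.2]

theorem dualEigenvalue_injective : Function.Injective hE.dualEigenvalue := by
  obtain ⟨v, hv⟩ := hQ.exists_sequence
  intro h h' hh
  obtain ⟨x, y, rfl⟩ := S.rel_surj h
  obtain ⟨x', y', rfl⟩ := S.rel_surj h'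
  have hE_eq : ∀ i, E i x y = E i x' y' := fun i => by
    refine mul_left_cancel₀ S.card_ne_zero ?_
    rw [← hE.dualEigenmatrix_rel, ← hE.dualEigenmatrix_rel, hv, hv, hh]
  have hmem : S.adj (S.rel x y) ∈ Submodule.span ℝ (Set.range E) := by
    rw [hE.span_eq]
    exact Submodule.subset_span ⟨_, rfl⟩
  obtain ⟨c, hc⟩ := (Submodule.mem_span_range_iff_exists_fun ℝ).1 hmem
  have hadj : S.adj (S.rel x y) x y = S.adj (S.rel x y) x' y' := by
    rw [← hc]
    simp [Matrix.sum_apply, hE_eq]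
  by_contra hne
  simp [adj, Ne.symm hne] at hadj

theorem sum_kernel_mul_eval {n : ℕ} (hn : n ≤ D + 1) {p : ℝ[X]} (hp : p.degree < n) :
    ∑ h, S.numPairs h * (hE.kernel n h * p.eval (hE.dualEigenvalue h)) =
      (Fintype.card X : ℝ) ^ 2 * p.eval (hE.dualEigenvalue 0) := by
  obtain ⟨v, hv⟩ := hQ.exists_sequence
  have hmem : p ∈ Submodule.span ℝ (v '' Set.Iio n) := by
    rw [v.span_degreeLT fun i _ => (leadingCoeff_ne_zero.2 (v.ne_zero i)).isUnit]
    exact mem_degreeLT.2 hp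
  clear hp
  induction hmem using Submodule.span_induction with
  | mem p hp =>
    obtain ⟨j, hj, rfl⟩ := hp
    have hj : j < n := hj
    have hsum := hE.sum_kernel_mul_dualEigenmatrix n ⟨j, hj.trans_le hn⟩
    simpa only [hv, if_pos hj] using hsum
  | zero => simp
  | add p q _ _ hp hq => simp only [eval_add, mul_add, Finset.sum_add_distrib, hp, hq]
  | smul c p _ hp =>
    simp only [eval_smul, smul_eq_mul, mul_left_comm _ c, ← Finset.mul_sum, hp]

theorem sum_dualEigenmatrix_mul_eval (j : Fin (D + 1)) {p : ℝ[X]} (hp : p.degree < (j : ℕ)) :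
    ∑ h, S.numPairs h * (hE.dualEigenmatrix j h * p.eval (hE.dualEigenvalue h)) = 0 := by
  have hj := hQ.sum_kernel_mul_eval j.2.le hp
  have hj_succ := hQ.sum_kernel_mul_eval (Nat.succ_le_of_lt j.2)
    (hp.trans (by exact_mod_cast Nat.lt_succ_self j))
  simp only [hE.kernel_succ j.is_le, add_mul, mul_add, Finset.sum_add_distrib, hj] at hj_succ
  simpa using hj_succ

theorem krein_eq_zero_of_succ_lt {i j : Fin (D + 1)} (hij : (i : ℕ) + 1 < j) :
    hE.krein 1 i j = 0 := by
  obtain ⟨v, hv⟩ := hQ.exists_sequence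
  have hdeg : (Polynomial.X * v i).degree < ((j : ℕ) : WithBot ℕ) := by
    rw [degree_mul, degree_X, v.degree_eq, add_comm]
    exact_mod_cast hij
  have hsum := hE.sum_dualEigenmatrix_mul_mul 1 i j
  simp only [dualEigenmatrix_one, mul_comm _ (hE.dualEigenmatrix j _)] at hsum
  have hzero := hQ.sum_dualEigenmatrix_mul_eval j hdeg
  simp only [eval_mul, eval_X, ← hv, hsum] at hzero
  simpa [S.card_ne_zero, (hE.dualEigenmatrix_zero_right_pos j).ne'] using hzero

theorem krein_eq_zero_of_lt_pred {i j : Fin (D + 1)} (hij : (j : ℕ) + 1 < i) :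
    hE.krein 1 i j = 0 := by
  have hsymm := hE.krein_mul_dualEigenmatrix 1 i j
  rw [hQ.krein_eq_zero_of_succ_lt hij, zero_mul] at hsymm
  exact (mul_eq_zero.1 hsymm).resolve_right (hE.dualEigenmatrix_zero_right_pos j).ne'

theorem sub_mul_kernel {i : ℕ} (hi : i + 1 ≤ D) (h : Fin (D + 1)) :
    (hE.dualEigenvalue 0 - hE.dualEigenvalue h) * hE.kernel (i + 1) h =
      hE.bStar i hi * hE.dualEigenmatrix ⟨i, by omega⟩ h -
        hE.cStar (i + 1) ⟨by omega, hi⟩ * hE.dualEigenmatrix ⟨i + 1, by omega⟩ h := by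
  -- Christoffel–Darboux: expanding both `θ_0` and `θ_h Q_{h,j}` in Krein parameters gives a double
  -- sum of antisymmetric terms, and only the pair `(i, i + 1)` crosses the cutoff.
  let F (j l : Fin (D + 1)) : ℝ :=
    hE.krein 1 l j * hE.dualEigenmatrix j h - hE.krein 1 j l * hE.dualEigenmatrix l h
  let s : Finset (Fin (D + 1)) := {j | (j : ℕ) < i + 1}
  have hexpand : ∀ j, (hE.dualEigenvalue 0 - hE.dualEigenvalue h) * hE.dualEigenmatrix j h =
      ∑ l, F j l := fun j => by
    rw [Finset.sum_sub_distrib, ← Finset.sum_mul, sum_krein, ← dualEigenmatrix_mul,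
      dualEigenmatrix_one, dualEigenmatrix_one, sub_mul]
  have hinner : ∑ j ∈ s, ∑ l ∈ s, F j l = 0 := by
    have hswap : ∑ j ∈ s, ∑ l ∈ s, F j l = -∑ j ∈ s, ∑ l ∈ s, F j l := by
      conv_lhs => rw [Finset.sum_comm]
      simp only [← Finset.sum_neg_distrib, F, neg_sub]
    linarith
  have houter : ∑ j ∈ s, ∑ l ∈ sᶜ, F j l = F ⟨i, by omega⟩ ⟨i + 1, by omega⟩ := by
    have hF : ∀ j l : Fin (D + 1), (j : ℕ) + 1 < l → F j l = 0 := fun j l hjl => by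
      simp only [F, hQ.krein_eq_zero_of_succ_lt hjl, hQ.krein_eq_zero_of_lt_pred hjl, zero_mul,
        sub_zero]
    rw [Finset.sum_eq_single_of_mem ⟨i, by omega⟩ (by simp [s]),
      Finset.sum_eq_single_of_mem ⟨i + 1, by omega⟩ (by simp [s])]
    · intro l hl hne
      simp only [s, Finset.mem_compl, Finset.mem_filter_univ] at hl
      simp only [ne_eq, Fin.ext_iff] at hne
      exact hF _ l (show i + 1 < l by omega)
    · intro j hj hne
      refine Finset.sum_eq_zero fun l hl => ?_
      simp only [s, Finset.mem_compl, Finset.mem_filter_univ] at hj hl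
      simp only [ne_eq, Fin.ext_iff] at hne
      exact hF j l (by omega)
  calc (hE.dualEigenvalue 0 - hE.dualEigenvalue h) * hE.kernel (i + 1) h
      = ∑ j ∈ s, (∑ l ∈ s, F j l + ∑ l ∈ sᶜ, F j l) := by
        simp only [kernel, Finset.mul_sum, hexpand, Finset.sum_add_sum_compl]
        rfl
    _ = F ⟨i, by omega⟩ ⟨i + 1, by omega⟩ := by
        rw [Finset.sum_add_distrib, hinner, houter, zero_add]

theorem cStar_mul_kernel {i : ℕ} (hi : i + 2 ≤ D) (h : Fin (D + 1)) :
    hE.cStar (i + 2) ⟨by omega, hi⟩ * hE.kernel (i + 3) h =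
      (hE.dualEigenvalue h - hE.dualEigenvalue 0 + hE.bStar (i + 1) hi +
        hE.cStar (i + 2) ⟨by omega, hi⟩) * hE.kernel (i + 2) h -
      hE.bStar (i + 1) hi * hE.kernel (i + 1) h := by
  have hCD := hQ.sub_mul_kernel hi h
  linear_combination hE.cStar (i + 2) ⟨by omega, hi⟩ * hE.kernel_succ hi h -
    hE.bStar (i + 1) hi * hE.kernel_succ (by omega : i + 1 ≤ D) h + hCD

theorem cStar_succ_pos {i : ℕ} (hi : i + 1 ≤ D) : 0 < hE.cStar (i + 1) ⟨by omega, hi⟩ := by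
  refine lt_of_le_of_ne' (hE.krein_nonneg _ _ _) fun hc : hE.cStar (i + 1) _ = 0 => ?_
  have hb : hE.bStar i hi = 0 := by
    have hsymm := hE.krein_mul_dualEigenmatrix 1 ⟨i, by omega⟩ ⟨i + 1, by omega⟩
    rw [show hE.krein 1 ⟨i, by omega⟩ ⟨i + 1, by omega⟩ = 0 from hc, zero_mul] at hsymm
    exact (mul_eq_zero.1 hsymm.symm).resolve_right (hE.dualEigenmatrix_zero_right_pos _).ne'
  have hkernel : ∀ h ≠ 0, hE.kernel (i + 1) h = 0 := fun h hh => by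
    have hCD := hQ.sub_mul_kernel hi h
    rw [hb, hc, zero_mul, zero_mul, sub_zero] at hCD
    exact (mul_eq_zero.1 hCD).resolve_left
      (sub_ne_zero.2 (hQ.dualEigenvalue_injective.ne hh.symm))
  have hsum := hE.sum_kernel_mul_dualEigenmatrix (i + 1) ⟨i + 1, by omega⟩
  rw [if_neg (lt_irrefl _), Fintype.sum_eq_single 0 fun h hh => by rw [hkernel h hh]; ring] at hsum
  have hpos : 0 < S.numPairs 0 * (hE.kernel (i + 1) 0 *
      hE.dualEigenmatrix ⟨i + 1, by omega⟩ 0) :=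
    mul_pos (Nat.cast_pos.2 (S.numPairs_pos 0))
      (mul_pos (hE.kernel_zero_right_pos i.succ_pos) (hE.dualEigenmatrix_zero_right_pos _))
  exact hpos.ne' hsum

theorem bStar_pos {i : ℕ} (hi : i + 1 ≤ D) : 0 < hE.bStar i hi := by
  have hsymm := hE.krein_mul_dualEigenmatrix 1 ⟨i, by omega⟩ ⟨i + 1, by omega⟩
  have hpos := mul_pos (hQ.cStar_succ_pos hi) (hE.dualEigenmatrix_zero_right_pos ⟨i + 1, by omega⟩)
  exact pos_of_mul_pos_left (hsymm ▸ hpos) (hE.dualEigenmatrix_zero_right_pos _).le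

theorem isOrthogonalBelow_of_eval_eq {n : ℕ} (hn : n ≤ D) {p : ℝ[X]} {c : ℝ}
    (hp : ∀ h, p.eval (hE.dualEigenvalue h + 1) = c * hE.kernel (n + 1) h) :
    IsOrthogonalBelow (Finset.Ioi 0) hE.weight (fun h => hE.dualEigenvalue h + 1) n p := by
  intro q hq
  let q' : ℝ[X] := (C (hE.dualEigenvalue 0) - Polynomial.X) * taylor 1 q
  have hq' : q'.degree < ((n + 1 : ℕ) : WithBot ℕ) := by
    have hlin : (C (hE.dualEigenvalue 0) - Polynomial.X : ℝ[X]).degree = 1 := by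
      rw [← neg_sub, degree_neg, degree_X_sub_C]
    rw [degree_mul, hlin, degree_taylor, add_comm, Nat.cast_add]
    exact WithBot.add_lt_add_right WithBot.one_ne_bot hq
  have hsum := hQ.sum_kernel_mul_eval (by omega) hq'
  simp only [q', eval_mul, eval_sub, eval_C, eval_X, taylor_eval, sub_self, zero_mul, mul_zero]
    at hsum
  have hzero : ∀ h ∉ Finset.Ioi 0, hE.weight h * (p.eval (hE.dualEigenvalue h + 1) *
      q.eval (hE.dualEigenvalue h + 1)) = 0 := fun h hh => by
    rw [Finset.mem_Ioi, Fin.pos_iff_ne_zero, not_not] at hh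
    rw [hh, weight, sub_self, mul_zero, zero_mul]
  rw [Finset.sum_subset (Finset.subset_univ _) fun h _ => hzero h, ← mul_zero c, ← hsum,
    Finset.mul_sum]
  refine Finset.sum_congr rfl fun h _ => ?_
  rw [hp, weight]
  ring

theorem cStar_mul_kernel_three (hD : 1 < D) (h : Fin (D + 1)) :
    hE.cStar 2 ⟨one_le_two, hD⟩ * hE.kernel 3 h =
      (hE.dualEigenvalue h + 1) ^ 2 -
        (hE.dualEigenvalue 0 + 1 - hE.bStar 1 hD - hE.cStar 2 ⟨one_le_two, hD⟩) *
          (hE.dualEigenvalue h + 1) - hE.bStar 1 hD := by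
  have hrec := hQ.cStar_mul_kernel (i := 0) hD h
  have htwo := hE.kernel_two (by omega) h
  linear_combination hrec - hE.bStar 1 hD * hE.kernel_one h +
    (hE.dualEigenvalue h - hE.dualEigenvalue 0 + hE.bStar 1 hD +
      hE.cStar 2 ⟨one_le_two, hD⟩) * htwo

theorem cStar_mul_cStar_mul_kernel_four (hD : 2 < D) (h : Fin (D + 1)) :
    hE.cStar 2 (by omega) * hE.cStar 3 (by omega) * hE.kernel 4 h =
      (recurrenceCubic (hE.dualEigenvalue 0 + 1 - hE.bStar 1 (by omega) - hE.cStar 2 (by omega))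
        (hE.bStar 1 (by omega))
        (hE.dualEigenvalue 0 + 1 - hE.bStar 2 hD - hE.cStar 3 (by omega))
        (hE.cStar 2 (by omega) * hE.bStar 2 hD)).eval (hE.dualEigenvalue h + 1) := by
  have hrec := hQ.cStar_mul_kernel (i := 1) hD h
  have hthree := hQ.cStar_mul_kernel_three (by omega) h
  have htwo := hE.kernel_two (by omega) h
  simp only [recurrenceCubic, eval_sub, eval_mul, eval_pow, eval_X, eval_C]
  linear_combination hE.cStar 2 (by omega) * hrec -
    hE.cStar 2 (by omega) * hE.bStar 2 hD * htwo +
    (hE.dualEigenvalue h - hE.dualEigenvalue 0 + hE.bStar 2 hD + hE.cStar 3 (by omega)) * hthree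

theorem isOrthogonalBelow_recurrenceCubic (hD : 2 < D) :
    IsOrthogonalBelow (Finset.Ioi 0) hE.weight (fun h => hE.dualEigenvalue h + 1) 3
      (recurrenceCubic (hE.dualEigenvalue 0 + 1 - hE.bStar 1 (by omega) - hE.cStar 2 (by omega))
        (hE.bStar 1 (by omega))
        (hE.dualEigenvalue 0 + 1 - hE.bStar 2 hD - hE.cStar 3 (by omega))
        (hE.cStar 2 (by omega) * hE.bStar 2 hD)) :=
  hQ.isOrthogonalBelow_of_eval_eq hD fun h => (hQ.cStar_mul_cStar_mul_kernel_four hD h).symm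

theorem sum_weight_mul_add_one (hD : 1 ≤ D) :
    ∑ h ∈ Finset.Ioi 0, hE.weight h * (hE.dualEigenvalue h + 1) = 0 := by
  have horth := hQ.isOrthogonalBelow_of_eval_eq hD (p := Polynomial.X) (c := 1) fun h => by
    rw [eval_X, one_mul, hE.kernel_two hD]
  simpa using horth 1 (by simp)

theorem sum_weight_mul_add_one_sq (hD : 1 < D) :
    ∑ h ∈ Finset.Ioi 0, hE.weight h * (hE.dualEigenvalue h + 1) ^ 2 =
      hE.bStar 1 hD * ∑ h ∈ Finset.Ioi 0, hE.weight h := by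
  let a := hE.dualEigenvalue 0 + 1 - hE.bStar 1 hD - hE.cStar 2 ⟨one_le_two, hD⟩
  have horth := hQ.isOrthogonalBelow_of_eval_eq hD
    (p := Polynomial.X ^ 2 - C a * Polynomial.X - C (hE.bStar 1 hD)) fun h => by
      simpa [a] using (hQ.cStar_mul_kernel_three hD h).symm
  have hsum := horth 1 (by simp)
  simp only [eval_sub, eval_mul, eval_pow, eval_X, eval_C, eval_one, mul_one, mul_sub,
    mul_left_comm _ a, mul_comm _ (hE.bStar 1 hD), Finset.sum_sub_distrib, ← Finset.mul_sum,
    hQ.sum_weight_mul_add_one (by omega : 1 ≤ D), mul_zero, sub_zero] at hsum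
  exact sub_eq_zero.1 hsum

section StrictAnti

variable (hθ : StrictAnti hE.dualEigenvalue)

include hθ

theorem add_one_mul_add_one_le (hD : 1 < D) :
    (hE.dualEigenvalue ⟨1, by omega⟩ + 1) * (hE.dualEigenvalue (Fin.last D) + 1) ≤
        -hE.bStar 1 hD ∧
      ((hE.dualEigenvalue ⟨1, by omega⟩ + 1) * (hE.dualEigenvalue (Fin.last D) + 1) =
        -hE.bStar 1 hD ↔ D = 2) := by
  have hanti := (hθ.add_const 1).antitone
  have hone : 1 < D + 1 := by omega
  have hbound := mul_extreme_nodes_le (ι := Fin (D + 1)) (i₁ := ⟨1, hone⟩) (i₂ := Fin.last D)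
    (fun h hh => hE.weight_pos hθ hh) (hQ.sum_weight_mul_add_one (by omega))
    (hQ.sum_weight_mul_add_one_sq hD) (Finset.mem_Ioi.2 (Fin.lt_def.2 Nat.one_pos))
    (fun h hh => hanti (Fin.le_def.2 (Fin.lt_def.1 (Finset.mem_Ioi.1 hh))))
    (fun h _ => hanti (Fin.le_last h))
  refine ⟨hbound.1, hbound.2.trans ?_⟩
  simp only [add_left_inj, hθ.injective.eq_iff, Fin.ext_iff, Finset.mem_Ioi, Fin.lt_def,
    Fin.val_last, Fin.val_zero]
  refine ⟨fun hall => ?_, fun hD h hh => ?_⟩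
  · have htwo : 2 = 1 ∨ 2 = D := hall ⟨2, by omega⟩ Nat.two_pos
    omega
  · omega

theorem prod_add_one_le_of_bStar_add_cStar_le (hD : 2 < D)
    (hbc : hE.bStar 2 hD + hE.cStar 3 (by omega) ≤ hE.dualEigenvalue 0 + 1) :
    (hE.dualEigenvalue ⟨1, by omega⟩ + 1) * (hE.dualEigenvalue ⟨2, by omega⟩ + 1) *
        (hE.dualEigenvalue (Fin.last D) + 1) ≤
      -hE.bStar 1 (by omega) *
        (hE.dualEigenvalue 0 + 1 - hE.bStar 2 hD - hE.cStar 3 (by omega)) ∧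
    ((hE.dualEigenvalue ⟨1, by omega⟩ + 1) * (hE.dualEigenvalue ⟨2, by omega⟩ + 1) *
        (hE.dualEigenvalue (Fin.last D) + 1) =
      -hE.bStar 1 (by omega) *
        (hE.dualEigenvalue 0 + 1 - hE.bStar 2 hD - hE.cStar 3 (by omega)) ↔ D = 3) := by
  have hanti := hθ.add_const 1
  have hone : 1 < D + 1 := by omega
  have htwo : 2 < D + 1 := by omega
  have hbound := (hQ.isOrthogonalBelow_recurrenceCubic hD).mul_three_nodes_le_of_nonneg
    (ι := Fin (D + 1)) (i₁ := ⟨1, hone⟩) (i₂ := ⟨2, htwo⟩) (i₃ := Fin.last D)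
    (fun h hh => hE.weight_pos hθ hh) (hQ.bStar_pos (by omega))
    (mul_pos (hQ.cStar_succ_pos (by omega)) (hQ.bStar_pos hD)) (by linarith)
    (Finset.mem_Ioi.2 (Fin.lt_def.2 Nat.one_pos)) (Finset.mem_Ioi.2 (Fin.lt_def.2 Nat.two_pos))
    (Finset.mem_Ioi.2 (Fin.lt_def.2 (show 0 < D by omega)))
    (hanti (Fin.mk_lt_mk.2 one_lt_two)) (hanti (Fin.mk_lt_mk.2 hD)) (fun h hh => ?_)
    (fun h _ => hanti.antitone (Fin.le_last h))
  · refine ⟨hbound.1, hbound.2.trans ?_⟩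
    simp only [add_left_inj, hθ.injective.eq_iff, Finset.mem_Ioi]
    exact forall_pos_eq_or_eq_or_eq_last_iff one_lt_two hD
  · obtain hh | hh := (show 1 ≤ (h : ℕ) from Finset.mem_Ioi.1 hh).eq_or_lt'
    · exact .inl (congrArg (hE.dualEigenvalue · + 1) (Fin.ext hh))
    · exact .inr (hanti.antitone (Fin.le_def.2 hh))

theorem le_prod_add_one_of_le_bStar_add_cStar (hD : 2 < D)
    (hbc : hE.dualEigenvalue 0 + 1 ≤ hE.bStar 2 hD + hE.cStar 3 (by omega)) :
    -hE.bStar 1 (by omega) *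
        (hE.dualEigenvalue 0 + 1 - hE.bStar 2 hD - hE.cStar 3 (by omega)) ≤
      (hE.dualEigenvalue ⟨1, by omega⟩ + 1) * (hE.dualEigenvalue ⟨D - 1, D.sub_lt_succ 1⟩ + 1) *
        (hE.dualEigenvalue (Fin.last D) + 1) ∧
    ((hE.dualEigenvalue ⟨1, by omega⟩ + 1) * (hE.dualEigenvalue ⟨D - 1, D.sub_lt_succ 1⟩ + 1) *
        (hE.dualEigenvalue (Fin.last D) + 1) =
      -hE.bStar 1 (by omega) *
        (hE.dualEigenvalue 0 + 1 - hE.bStar 2 hD - hE.cStar 3 (by omega)) ↔ D = 3) := by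
  have hanti := hθ.add_const 1
  have hone : 1 < D + 1 := by omega
  have hpred : 1 < D - 1 := by omega
  have hpred_lt : D - 1 < D := by omega
  have hbound := (hQ.isOrthogonalBelow_recurrenceCubic hD).le_mul_three_nodes_of_nonpos
    (ι := Fin (D + 1)) (i₁ := ⟨1, hone⟩) (i₂ := ⟨D - 1, D.sub_lt_succ 1⟩)
    (i₃ := Fin.last D)
    (fun h hh => hE.weight_pos hθ hh) (hQ.bStar_pos (by omega))
    (mul_pos (hQ.cStar_succ_pos (by omega)) (hQ.bStar_pos hD)) (by linarith)
    (Finset.mem_Ioi.2 (Fin.lt_def.2 Nat.one_pos))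
    (Finset.mem_Ioi.2 (Fin.lt_def.2 (Nat.one_pos.trans hpred)))
    (Finset.mem_Ioi.2 (Fin.lt_def.2 (show 0 < D by omega)))
    (hanti (Fin.mk_lt_mk.2 hpred)) (hanti (Fin.mk_lt_mk.2 hpred_lt))
    (fun h hh => hanti.antitone (Fin.le_def.2 (Fin.lt_def.1 (Finset.mem_Ioi.1 hh))))
    (fun h _ => ?_)
  · refine ⟨hbound.1, hbound.2.trans ?_⟩
    simp only [add_left_inj, hθ.injective.eq_iff, Finset.mem_Ioi]
    exact forall_pos_eq_or_eq_or_eq_last_iff hpred hpred_lt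
  · obtain hh | hh := h.is_le.eq_or_lt
    · exact .inl (congrArg (hE.dualEigenvalue · + 1) (Fin.ext hh))
    · exact .inr (hanti.antitone (Fin.le_def.2 (Nat.le_sub_one_of_lt hh)))

end StrictAnti

end IsQPolynomial

end IsPrimitiveIdempotents

end AssociationScheme

/-- The hypothesis `hθ` only fixes the labelling of the relations `R_1, …, R_D`; that the dual
eigenvalues are then strictly decreasing is part of the conclusion. The number `m` of the
statement is `θ*_0`. -/
theorem theorem4p1 {X : Type*} [Fintype X] [DecidableEq X] {D : ℕ} (hD : 2 ≤ D)
    (S : AssociationScheme X D) (E : Fin (D + 1) → Matrix X X ℝ)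
    (hE : S.IsPrimitiveIdempotents E) (hQ : hE.IsQPolynomial)
    (θ : Fin (D + 1) → ℝ) (hθ_def : θ = hE.dualEigenvalue) (hθ : Antitone θ)
    (m : ℝ) (hm : m = θ 0) :
    StrictAnti θ ∧
    ((θ ⟨1, by omega⟩ + 1) * (θ ⟨D, by omega⟩ + 1) ≤ -hE.bStar 1 (by omega) ∧
      ((θ ⟨1, by omega⟩ + 1) * (θ ⟨D, by omega⟩ + 1) = -hE.bStar 1 (by omega) ↔ D = 2)) ∧
    ∀ hD3 : 3 ≤ D,
      (hE.bStar 2 (by omega) + hE.cStar 3 (by omega) ≥ m + 1 →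
        (θ ⟨1, by omega⟩ + 1) * (θ ⟨D - 1, by omega⟩ + 1) * (θ ⟨D, by omega⟩ + 1) ≥
            -hE.bStar 1 (by omega) *
              (m + 1 - hE.bStar 2 (by omega) - hE.cStar 3 (by omega)) ∧
        ((θ ⟨1, by omega⟩ + 1) * (θ ⟨D - 1, by omega⟩ + 1) * (θ ⟨D, by omega⟩ + 1) =
            -hE.bStar 1 (by omega) *
              (m + 1 - hE.bStar 2 (by omega) - hE.cStar 3 (by omega)) ↔ D = 3)) ∧
      (hE.bStar 2 (by omega) + hE.cStar 3 (by omega) ≤ m + 1 →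
        (θ ⟨1, by omega⟩ + 1) * (θ ⟨2, by omega⟩ + 1) * (θ ⟨D, by omega⟩ + 1) ≤
            -hE.bStar 1 (by omega) *
              (m + 1 - hE.bStar 2 (by omega) - hE.cStar 3 (by omega)) ∧
        ((θ ⟨1, by omega⟩ + 1) * (θ ⟨2, by omega⟩ + 1) * (θ ⟨D, by omega⟩ + 1) =
            -hE.bStar 1 (by omega) *
              (m + 1 - hE.bStar 2 (by omega) - hE.cStar 3 (by omega)) ↔ D = 3)) := by
  subst hθ_def hm
  have hanti : StrictAnti hE.dualEigenvalue :=
    hθ.strictAnti_of_injective hQ.dualEigenvalue_injective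
  refine ⟨hanti, hQ.add_one_mul_add_one_le hanti hD, fun hD3 => ⟨fun hbc => ?_, fun hbc => ?_⟩⟩
  · exact hQ.le_prod_add_one_of_le_bStar_add_cStar hanti hD3 hbc
  · exact hQ.prod_add_one_le_of_bStar_add_cStar_le hanti hD3 hbc
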